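/- Let $p$ be a prime and let $j\in\{0,1,\dots,p-1\}$. A set $R\subseteq\mathbb Z_{p^4}=\mathbb Z/p^4\mathbb Z$ is called a root set if there is a polynomial $f\in\mathbb Z_{p^4}[x]$ whose roots in $\mathbb Z_{p^4}$ are exactly the elements of $R$; put $R_j=\{r\in R : r\equiv j \pmod p\}$. For $a\in\mathbb Z_{p^4}$ write $a+p^i\ast=\{a+p^iy : y\in\mathbb Z_{p^4}\}$. All digits $\alpha,\alpha_1,\alpha_2,\alpha_3,\beta_1,\beta_2$ below range over $\{0,1,\dots,p-1\}$. Then the sets that occur as $R_j$ for some root set $R$ in $\mathbb Z_{p^4}$ are exactly the following, where the number of sets of each kind is given in brackets: 1. $j+p\ast$ $\;[1]$; 2. $(j+p\alpha_1+p^2\ast)\cup(j+p\alpha_2+p^2\ast)\cup(j+p\alpha_3+p^2\ast)$ with $\alpha_1,\alpha_2,\alpha_3$ pairwise distinct $\;\left[\frac{p(p-1)(p-2)}{6}\right]$; 3. $(j+p\alpha_1+p^2\ast)\cup(j+p\alpha_2+p^2\ast)$ with $\alpha_1\ne\alpha_2$ $\;\left[\frac{p(p-1)}{2}\right]$; 4.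 $j+p\alpha+p^2\ast$ $\;[p]$; 5. $(j+p\alpha_1+p^2\beta_1+p^3\ast)\cup(j+p\alpha_2+p^2\beta_2+p^3\ast)$ with $\alpha_1\neq\alpha_2$ $\;\left[\frac{p^3(p-1)}{2}\right]$; 6. $j+p\alpha_1+p^2\alpha_2+p^3\ast$ $\;[p^2]$; 7. the single element set $\{j+p\alpha_1+p^2\alpha_2+p^3\alpha_3\}$ $\;[p^3]$; 8. $\emptyset$ $\;[1]$. If moreover $p\ge 5$, then no set is of two different kinds, and the number $N_{p^4}$ of possible sets $R_j$ (for each fixed $j$) is $$N_{p^4}=\frac{3p^4+4p^3+6p^2+5p+12}{6}.$$ -/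

import Mathlib

open Polynomial

/-- `S` is a root set in the ring `A`: it is exactly the set of roots in `A` of some polynomial
with coefficients in `A` (the zero polynomial is allowed). -/
def IsRootSet {A : Type*} [CommRing A] (S : Set A) : Prop :=
  ∃ f : A[X], S = {x : A | f.eval x = 0}

/-- The part `R_j` of `R ⊆ ℤ/p^k` consisting of the elements congruent to `j` modulo `p`. -/
def residuePart (p k j : ℕ) (R : Set (ZMod (p ^ k))) : Set (ZMod (p ^ k)) :=
  {r | r ∈ R ∧ r.val ≡ j [MOD p]}

/-- All the sets `R_j` that occur, for a fixed `j`, as `R` runs over the root sets in `ℤ/p^k`. -/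
def possibleParts (p k j : ℕ) : Set (Set (ZMod (p ^ k))) :=
  {T | ∃ R : Set (ZMod (p ^ k)), IsRootSet R ∧ T = residuePart p k j R}

/-- The representative root `a + p^i *` in `ℤ/p^k`: all elements `a + p^i y`. -/
def repRoot (p k i a : ℕ) : Set (ZMod (p ^ k)) :=
  {x | ∃ y : ZMod (p ^ k), x = (a : ZMod (p ^ k)) + (p : ZMod (p ^ k)) ^ i * y}

/-- The eight kinds of subsets of the residue class of `j` modulo `p` in `ℤ/p^4`, in order:
the full class; unions of three, of two, and of one subtree `j + p α + p^2 *`;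
unions of two subtrees `j + p α + p^2 β + p^3 *` with distinct `α`'s; one such subtree;
a single element; the empty set. All digits lie in `{0, …, p - 1}`. -/
def rootSetKind (p j : ℕ) : Fin 8 → Set (Set (ZMod (p ^ 4))) :=
  ![{T | T = repRoot p 4 1 j},
    {T | ∃ a₁ < p, ∃ a₂ < p, ∃ a₃ < p, a₁ ≠ a₂ ∧ a₁ ≠ a₃ ∧ a₂ ≠ a₃ ∧
      T = repRoot p 4 2 (j + p * a₁) ∪ repRoot p 4 2 (j + p * a₂) ∪ repRoot p 4 2 (j + p * a₃)},
    {T | ∃ a₁ < p, ∃ a₂ < p, a₁ ≠ a₂ ∧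
      T = repRoot p 4 2 (j + p * a₁) ∪ repRoot p 4 2 (j + p * a₂)},
    {T | ∃ a < p, T = repRoot p 4 2 (j + p * a)},
    {T | ∃ a₁ < p, ∃ a₂ < p, ∃ b₁ < p, ∃ b₂ < p, a₁ ≠ a₂ ∧
      T = repRoot p 4 3 (j + p * a₁ + p ^ 2 * b₁) ∪ repRoot p 4 3 (j + p * a₂ + p ^ 2 * b₂)},
    {T | ∃ a₁ < p, ∃ a₂ < p, T = repRoot p 4 3 (j + p * a₁ + p ^ 2 * a₂)},
    {T | ∃ a₁ < p, ∃ a₂ < p, ∃ a₃ < p,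
      T = {((j + p * a₁ + p ^ 2 * a₂ + p ^ 3 * a₃ : ℕ) : ZMod (p ^ 4))}},
    {T | T = ∅}]

/-- The number of root sets of each of the eight kinds. -/
def rootSetKindCount (p : ℚ) : Fin 8 → ℚ :=
  ![1,
    p * (p - 1) * (p - 2) / 6,
    p * (p - 1) / 2,
    p,
    p ^ 3 * (p - 1) / 2,
    p ^ 2,
    p ^ 3,
    1]

/-!
The class of `j` in `ℤ/p^4` is the set of elements `j + p y`, with `y` determined modulo `p ^ 3`.
By Taylor expansion at `j`, and because `p ^ 4 = 0`, a polynomial restricts to this class as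
`a₀ + a₁ (p y) + a₂ (p y) ^ 2 + a₃ (p y) ^ 3` with integers `aᵢ`, and every choice of the `aᵢ`
occurs (`mem_possibleParts_iff`). So the possible parts correspond to the solution sets in `y ∈ ℤ`
of such an expression being divisible by `p ^ 4`.

The classification of these solution sets (`isKindSet_solutions`) divides out powers of `p`.
* If `p ∤ a₀`, there is no solution.
* If `p ∣ a₀` and `p ∤ a₁`, one factor `p` cancels, and the remaining polynomial is a bijection
  modulo `p ^ 3`, so there is exactly one solution modulo `p ^ 3` (`exists_hensel`).
* If `p ∣ a₀` and `p ∣ a₁`, solutions can exist only if `p ^ 2 ∣ a₀`, and then two factors `p`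
  cancel. What remains is a congruence modulo `p ^ 2` whose reduction modulo `p` is at most
  quadratic. If this reduction is not zero, a simple root modulo `p` lifts uniquely to modulo
  `p ^ 2`, while on the class of a double root, which is then the only root, the congruence holds
  everywhere or nowhere (`isKindSet_quadratic`).
* If this reduction is zero, a third factor `p` cancels and an arbitrary cubic congruence modulo
  `p` is left. It has at most three roots, or holds identically (`isKindSet_cubic`).

Conversely, each kind but the empty set is realised by a product of linear factors in `y`
times a power of `p` (`exists_coeffs`).

For the counts, each kind is the injective image of a family of finite sets of digits
(`rootSetKind_eq_image`, `subtreeUnion_injOn`): a set `A` of `m` integers in `[0, p ^ i)`, pairwise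
incongruent modulo `p`, is sent to the union of the subtrees `j + p c + p ^ (i + 1) *` with `c ∈ A`.
That union has `m p ^ (3 - i)` elements. For `p ≥ 5` these cardinalities decrease strictly along the
list of kinds, so the kinds are disjoint and the counts add up. For `p = 3` three subtrees of the
second kind fill the whole class, and for `p = 2` two subtrees of the third kind do.
-/

/-! ### Unions of subtrees of a residue class -/

/-- The element `j + p y` of `ℤ/p^4`. -/
def classPoint (p j : ℕ) (y : ℤ) : ZMod (p ^ 4) := ((j + p * y : ℤ) : ZMod (p ^ 4))

/-- The integers congruent modulo `p ^ i` to an element of `A`. -/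
def residueUnion (p i : ℕ) (A : Finset ℕ) : Set ℤ := {y | ∃ c ∈ A, (p : ℤ) ^ i ∣ y - c}

/-- The union of the subtrees `j + p c + p ^ (i + 1) *` of `ℤ/p^4` over `c ∈ A`, described as the
set of all `j + p y` with `y` congruent modulo `p ^ i` to an element of `A`. -/
def subtreeUnion (p j i : ℕ) (A : Finset ℕ) : Set (ZMod (p ^ 4)) :=
  classPoint p j '' residueUnion p i A

/-- The level `i` such that the sets of the `k`-th kind are unions of subtrees
`j + p c + p ^ (i + 1) *`. For the empty set the level is immaterial. -/
def kindLevel : Fin 8 → ℕ := ![0, 1, 1, 1, 2, 2, 3, 0]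

/-- The number of subtrees of level `kindLevel k` in a set of the `k`-th kind. -/
def kindSize : Fin 8 → ℕ := ![1, 3, 2, 1, 2, 1, 1, 0]

theorem kindLevel_le (k : Fin 8) : kindLevel k ≤ 3 := by revert k; decide

/-- The sets of subtree indices that give the sets of the `k`-th kind. Incongruence modulo `p` is a
restriction for the fifth kind only: in all other kinds there is at most one index, or the indices
are less than `p`. -/
def digitFamily (p : ℕ) (k : Fin 8) : Finset (Finset ℕ) :=
  {A ∈ Finset.powersetCard (kindSize k) (Finset.range (p ^ kindLevel k)) |
    ∀ a ∈ A, ∀ b ∈ A, a % p = b % p → a = b}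

theorem mem_digitFamily {p : ℕ} {k : Fin 8} {A : Finset ℕ} :
    A ∈ digitFamily p k ↔ ((∀ a ∈ A, a < p ^ kindLevel k) ∧ A.card = kindSize k) ∧
      ∀ a ∈ A, ∀ b ∈ A, a % p = b % p → a = b := by
  simp [digitFamily, Finset.mem_powersetCard, Finset.subset_iff]

theorem classPoint_eq_iff {p : ℕ} (hp : p ≠ 0) (j : ℕ) (y z : ℤ) :
    classPoint p j y = classPoint p j z ↔ (p : ℤ) ^ 3 ∣ y - z := by
  have hp' : (p : ℤ) ≠ 0 := by exact_mod_cast hp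
  rw [classPoint, classPoint, eq_comm, ZMod.intCast_eq_intCast_iff_dvd_sub,
    show (j + p * y - (j + p * z) : ℤ) = p * (y - z) by ring,
    show ((p ^ 4 : ℕ) : ℤ) = p * (p : ℤ) ^ 3 by push_cast; ring, mul_dvd_mul_iff_left hp']

theorem classPoint_mem_subtreeUnion {p : ℕ} (hp : p ≠ 0) (j : ℕ) {i : ℕ} (hi : i ≤ 3)
    (A : Finset ℕ) (y : ℤ) :
    classPoint p j y ∈ subtreeUnion p j i A ↔ ∃ c ∈ A, (p : ℤ) ^ i ∣ y - c := by
  constructor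
  · rintro ⟨z, ⟨c, hc, hz⟩, hzy⟩
    rw [classPoint_eq_iff hp] at hzy
    refine ⟨c, hc, ?_⟩
    have := dvd_sub hz ((pow_dvd_pow (p : ℤ) hi).trans hzy)
    rwa [show z - c - (z - y) = y - c by ring] at this
  · exact fun h => ⟨y, h, rfl⟩

theorem eq_of_pow_dvd_sub {p i : ℕ} {a b : ℕ} (ha : a < p ^ i) (hb : b < p ^ i)
    (h : (p : ℤ) ^ i ∣ (a : ℤ) - b) : a = b := by
  have h' : ((p ^ i : ℕ) : ℤ) ∣ (a : ℤ) - b := by exact_mod_cast h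
  exact (((Nat.modEq_iff_dvd.mpr h').symm).eq_of_lt_of_lt ha hb)

theorem subtreeUnion_injOn {p : ℕ} (hp : p ≠ 0) (j : ℕ) {i : ℕ} (hi : i ≤ 3) :
    Set.InjOn (subtreeUnion p j i) {A | ∀ a ∈ A, a < p ^ i} := by
  have key : ∀ A : Finset ℕ, (∀ a ∈ A, a < p ^ i) → ∀ c, c < p ^ i →
      (c ∈ A ↔ classPoint p j c ∈ subtreeUnion p j i A) := by
    intro A hA c hc
    rw [classPoint_mem_subtreeUnion hp j hi]
    constructor
    · exact fun h => ⟨c, h, by simp⟩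
    · rintro ⟨a, ha, hd⟩
      rwa [eq_of_pow_dvd_sub hc (hA a ha) hd]
  intro A hA B hB hAB
  ext c
  by_cases hc : c < p ^ i
  · rw [key A hA c hc, key B hB c hc, hAB]
  · exact ⟨fun h => absurd (hA c h) hc, fun h => absurd (hB c h) hc⟩

/-- A subtree of level `i` contains the points `j + p (c + p ^ i t)` with `0 ≤ t < p ^ (3 - i)`. -/
theorem ncard_subtreeUnion {p : ℕ} (hp : p ≠ 0) (j : ℕ) {i : ℕ} (hi : i ≤ 3) {A : Finset ℕ}
    (hA : ∀ a ∈ A, a < p ^ i) : (subtreeUnion p j i A).ncard = A.card * p ^ (3 - i) := by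
  have hpow : p ^ i * p ^ (3 - i) = p ^ 3 := by rw [← pow_add]; congr 1; omega
  have hpos : 0 < p ^ i := pow_pos (Nat.pos_of_ne_zero hp) i
  have himage : subtreeUnion p j i A = (fun q : ℕ × ℕ => classPoint p j (q.1 + p ^ i * q.2)) ''
      (A ×ˢ Finset.range (p ^ (3 - i)) : Finset (ℕ × ℕ)) := by
    ext x
    constructor
    · rintro ⟨y, ⟨c, hc, t, ht⟩, rfl⟩
      have hM : (0 : ℤ) < ((p ^ (3 - i) : ℕ) : ℤ) := by
        exact_mod_cast pow_pos (Nat.pos_of_ne_zero hp) _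
      have hnn := Int.emod_nonneg t hM.ne'
      have hlt := Int.emod_lt_of_pos t hM
      refine ⟨(c, (t % ((p ^ (3 - i) : ℕ) : ℤ)).toNat), ?_, ?_⟩
      · simp only [Finset.coe_product, Set.mem_prod, Finset.mem_coe, Finset.mem_range]
        exact ⟨hc, by omega⟩
      · dsimp only
        rw [classPoint_eq_iff hp, Int.toNat_of_nonneg hnn, Int.emod_def]
        refine ⟨-(t / ((p ^ (3 - i) : ℕ) : ℤ)), ?_⟩
        have hpow' : (p : ℤ) ^ i * ((p ^ (3 - i) : ℕ) : ℤ) = (p : ℤ) ^ 3 := by exact_mod_cast hpow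
        rw [← hpow']
        linear_combination -ht
    · rintro ⟨⟨c, t⟩, hct, rfl⟩
      simp only [Finset.coe_product, Set.mem_prod, Finset.mem_coe] at hct
      exact ⟨_, ⟨c, hct.1, t, by ring⟩, rfl⟩
  rw [himage, Set.InjOn.ncard_image, Set.ncard_coe_finset, Finset.card_product, Finset.card_range]
  rintro ⟨c, t⟩ hct ⟨c', t'⟩ hct' h
  simp only [Finset.coe_product, Set.mem_prod, Finset.mem_coe, Finset.mem_range] at hct hct'
  dsimp only at h
  rw [classPoint_eq_iff hp] at h
  have hbound : ∀ a b : ℕ, a < p ^ i → b < p ^ (3 - i) → a + p ^ i * b < p ^ 3 := by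
    intro a b ha hb
    rw [← hpow]
    nlinarith [Nat.mul_le_mul_left (p ^ i) (Nat.succ_le_of_lt hb)]
  have heq := eq_of_pow_dvd_sub (hbound c t (hA c hct.1) hct.2)
    (hbound c' t' (hA c' hct'.1) hct'.2) (by exact_mod_cast h)
  have hc : c = c' := by
    have := congrArg (· % p ^ i) heq
    simpa [Nat.add_mul_mod_self_left, Nat.mod_eq_of_lt (hA c hct.1),
      Nat.mod_eq_of_lt (hA c' hct'.1)] using this
  subst hc
  have : t = t' := Nat.eq_of_mul_eq_mul_left hpos (by omega)
  rw [this]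

theorem repRoot_eq_subtreeUnion (p j i c : ℕ) :
    repRoot p 4 (i + 1) (j + p * c) = subtreeUnion p j i {c} := by
  ext x
  constructor
  · rintro ⟨y, rfl⟩
    obtain ⟨t, rfl⟩ := ZMod.intCast_surjective y
    refine ⟨c + p ^ i * t, ⟨c, Finset.mem_singleton_self c, t, by ring⟩, ?_⟩
    simp only [classPoint]; push_cast; ring
  · rintro ⟨y, ⟨c', hc, t, ht⟩, rfl⟩
    obtain rfl := Finset.mem_singleton.mp hc
    refine ⟨t, ?_⟩
    rw [show y = c' + p ^ i * t by linear_combination ht]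
    simp only [classPoint]; push_cast; ring

theorem subtreeUnion_union (p j i : ℕ) (A B : Finset ℕ) :
    subtreeUnion p j i (A ∪ B) = subtreeUnion p j i A ∪ subtreeUnion p j i B := by
  rw [subtreeUnion, subtreeUnion, subtreeUnion, ← Set.image_union]
  congr 1
  ext y
  simp [residueUnion, or_and_right, exists_or]

/-! ### The eight kinds as families of unions of subtrees -/

/-- Each kind is parametrised by its family of digit sets. The digits `a`, `b`, … of an index
are the base-`p` digits of `c = a + p b + …`. -/
theorem rootSetKind_eq_image {p : ℕ} (hp : p.Prime) (j : ℕ) (k : Fin 8) :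
    rootSetKind p j k = subtreeUnion p j (kindLevel k) '' (digitFamily p k) := by
  have pair : ∀ i a b, subtreeUnion p j i {a, b} =
      repRoot p 4 (i + 1) (j + p * a) ∪ repRoot p 4 (i + 1) (j + p * b) := by
    intro i a b
    rw [repRoot_eq_subtreeUnion, repRoot_eq_subtreeUnion, ← subtreeUnion_union]; rfl
  have triple : ∀ i a b c, subtreeUnion p j i {a, b, c} =
      repRoot p 4 (i + 1) (j + p * a) ∪ repRoot p 4 (i + 1) (j + p * b) ∪
        repRoot p 4 (i + 1) (j + p * c) := by
    intro i a b c
    rw [repRoot_eq_subtreeUnion p j i a, Set.union_assoc, ← pair, ← subtreeUnion_union]; rfl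
  have two_digits : ∀ a b, a < p → b < p → a + p * b < p ^ 2 := by
    intro a b ha hb; nlinarith
  have div_lt : ∀ a, a < p ^ 2 → a / p < p := by
    intro a ha; exact Nat.div_lt_of_lt_mul (by rwa [← sq])
  ext T
  rw [Set.mem_image]
  fin_cases k <;>
    simp only [Finset.mem_coe, mem_digitFamily, rootSetKind, kindLevel, kindSize, Fin.zero_eta,
      Fin.mk_one, Fin.reduceFinMk, Matrix.cons_val, Set.mem_ofPred_eq, Finset.card_eq_one,
      Finset.card_eq_two, Finset.card_eq_three, Finset.card_eq_zero]
  · constructor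
    · rintro rfl
      refine ⟨{0}, by simp, ?_⟩
      rw [← repRoot_eq_subtreeUnion]; rfl
    · rintro ⟨_, ⟨⟨h, c, rfl⟩, -⟩, rfl⟩
      have hc : c = 0 := by simpa using h c
      rw [hc, ← repRoot_eq_subtreeUnion]; rfl
  · constructor
    · rintro ⟨a, ha, b, hb, c, hc, hab, hac, hbc, rfl⟩
      refine ⟨{a, b, c}, ⟨⟨?_, a, b, c, hab, hac, hbc, rfl⟩, ?_⟩, triple 1 a b c⟩
      · simp [ha, hb, hc]
      · simp [Nat.mod_eq_of_lt, ha, hb, hc]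
    · rintro ⟨_, ⟨⟨h, a, b, c, hab, hac, hbc, rfl⟩, -⟩, rfl⟩
      simp only [pow_one, Finset.mem_insert, Finset.mem_singleton] at h
      exact ⟨a, h a (by simp), b, h b (by simp), c, h c (by simp), hab, hac, hbc, triple 1 a b c⟩
  · constructor
    · rintro ⟨a, ha, b, hb, hab, rfl⟩
      refine ⟨{a, b}, ⟨⟨?_, a, b, hab, rfl⟩, ?_⟩, pair 1 a b⟩
      · simp [ha, hb]
      · simp [Nat.mod_eq_of_lt, ha, hb]
    · rintro ⟨_, ⟨⟨h, a, b, hab, rfl⟩, -⟩, rfl⟩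
      simp only [pow_one, Finset.mem_insert, Finset.mem_singleton] at h
      exact ⟨a, h a (by simp), b, h b (by simp), hab, pair 1 a b⟩
  · constructor
    · rintro ⟨a, ha, rfl⟩
      exact ⟨{a}, by simp [ha], (repRoot_eq_subtreeUnion p j 1 a).symm⟩
    · rintro ⟨_, ⟨⟨h, a, rfl⟩, -⟩, rfl⟩
      exact ⟨a, by simpa using h a, (repRoot_eq_subtreeUnion p j 1 a).symm⟩
  · constructor
    · rintro ⟨a, ha, b, hb, c, hc, d, hd, hab, rfl⟩
      have hne : a + p * c ≠ b + p * d := by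
        intro h
        have := congrArg (· % p) h
        simp [Nat.mod_eq_of_lt, ha, hb, hab] at this
      refine ⟨{a + p * c, b + p * d}, ⟨⟨?_, _, _, hne, rfl⟩, ?_⟩, ?_⟩
      · simp [two_digits, ha, hb, hc, hd]
      · simp [Nat.mod_eq_of_lt, ha, hb, hab, hab.symm]
      · rw [pair]; ring_nf
    · rintro ⟨_, ⟨⟨h, a, b, hab, rfl⟩, hinj⟩, rfl⟩
      have ha : a < p ^ 2 := h a (by simp)
      have hb : b < p ^ 2 := h b (by simp)
      refine ⟨a % p, Nat.mod_lt _ hp.pos, b % p, Nat.mod_lt _ hp.pos, a / p, div_lt a ha,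
        b / p, div_lt b hb, fun hmod => hab (hinj a (by simp) b (by simp) hmod), ?_⟩
      rw [pair, sq, mul_assoc, mul_assoc, add_assoc, add_assoc, ← mul_add, ← mul_add,
        Nat.mod_add_div, Nat.mod_add_div]
  · constructor
    · rintro ⟨a, ha, b, hb, rfl⟩
      refine ⟨{a + p * b}, by simp [two_digits, ha, hb], ?_⟩
      rw [← repRoot_eq_subtreeUnion]; ring_nf
    · rintro ⟨_, ⟨⟨h, a, rfl⟩, -⟩, rfl⟩
      refine ⟨a % p, Nat.mod_lt _ hp.pos, a / p, div_lt a (h a (by simp)), ?_⟩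
      rw [← repRoot_eq_subtreeUnion, sq, mul_assoc, add_assoc, ← mul_add, Nat.mod_add_div]
  · have single : ∀ c, subtreeUnion p j 3 {c} = {((j + p * c : ℕ) : ZMod (p ^ 4))} := by
      intro c
      have h0 : (p : ZMod (p ^ 4)) ^ 4 = 0 := by exact_mod_cast ZMod.natCast_self (p ^ 4)
      rw [← repRoot_eq_subtreeUnion]
      ext x
      simp [repRoot, h0]
    constructor
    · rintro ⟨a, ha, b, hb, c, hc, rfl⟩
      refine ⟨{a + p * (b + p * c)}, ?_, ?_⟩
      · have := two_digits b c hb hc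
        simp
        nlinarith
      · rw [single]; ring_nf
    · rintro ⟨_, ⟨⟨h, a, rfl⟩, -⟩, rfl⟩
      have ha : a / p < p ^ 2 :=
        Nat.div_lt_of_lt_mul (by rw [mul_comm, ← pow_succ]; exact h a (by simp))
      refine ⟨a % p, Nat.mod_lt _ hp.pos, a / p % p, Nat.mod_lt _ hp.pos, a / p / p,
        div_lt _ ha, ?_⟩
      rw [single, show j + p * (a % p) + p ^ 2 * (a / p % p) + p ^ 3 * (a / p / p) =
        j + p * (a % p + p * (a / p % p + p * (a / p / p))) by ring, Nat.mod_add_div,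
        Nat.mod_add_div]
  · constructor
    · rintro rfl
      exact ⟨∅, by simp, by simp [subtreeUnion, residueUnion]⟩
    · rintro ⟨_, ⟨⟨-, rfl⟩, -⟩, rfl⟩
      simp [subtreeUnion, residueUnion]

/-! ### Counting -/

theorem card_digitFamily {p : ℕ} (hp : p.Prime) (k : Fin 8) :
    ((digitFamily p k).card : ℚ) = rootSetKindCount (p : ℚ) k := by
  have hfilter : ∀ k, k ≠ 4 → digitFamily p k =
      Finset.powersetCard (kindSize k) (Finset.range (p ^ kindLevel k)) := by
    intro k hk
    refine Finset.filter_true_of_mem fun A hA a ha b hb hab => ?_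
    rw [Finset.mem_powersetCard] at hA
    by_cases hs : kindSize k ≤ 1
    · exact Finset.card_le_one.mp (hA.2.trans_le hs) a ha b hb
    · have hlevel : kindLevel k = 1 := by clear hA; revert k; decide
      rw [hlevel, pow_one] at hA
      rwa [Nat.mod_eq_of_lt (Finset.mem_range.mp (hA.1 ha)),
        Nat.mod_eq_of_lt (Finset.mem_range.mp (hA.1 hb))] at hab
  have hcard : ∀ k, k ≠ 4 → (digitFamily p k).card = (p ^ kindLevel k).choose (kindSize k) := by
    intro k hk
    rw [hfilter k hk, Finset.card_powersetCard, Finset.card_range]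
  by_cases hk : k = 4
  · subst hk
    -- Ordering the two indices by their residues `a < b` modulo `p` parametrises the unordered
    -- pairs; the second digits `c`, `d` are free.
    have himage : digitFamily p 4 = (((Finset.range p).sigma fun b => Finset.range b) ×ˢ
        (Finset.range p ×ˢ Finset.range p)).image
        fun q => {q.1.2 + p * q.2.1, q.1.1 + p * q.2.2} := by
      ext A
      simp only [mem_digitFamily, kindLevel, kindSize, Matrix.cons_val, Finset.card_eq_two,
        Finset.mem_image, Finset.mem_product, Finset.mem_sigma, Finset.mem_range, Prod.exists,
        Sigma.exists]
      constructor
      · rintro ⟨⟨hlt, x, y, hxy, rfl⟩, hinj⟩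
        have hx : x / p < p := Nat.div_lt_of_lt_mul (by rw [← sq]; exact hlt x (by simp))
        have hy : y / p < p := Nat.div_lt_of_lt_mul (by rw [← sq]; exact hlt y (by simp))
        have hne : x % p ≠ y % p := fun h => hxy (hinj x (by simp) y (by simp) h)
        rcases hne.lt_or_gt with h | h
        · exact ⟨y % p, x % p, x / p, y / p, ⟨⟨Nat.mod_lt _ hp.pos, h⟩, hx, hy⟩, by
            simp only [Nat.mod_add_div]⟩
        · exact ⟨x % p, y % p, y / p, x / p, ⟨⟨Nat.mod_lt _ hp.pos, h⟩, hy, hx⟩, by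
            simp only [Nat.mod_add_div]; exact Finset.pair_comm _ _⟩
      · rintro ⟨b, a, c, d, ⟨⟨hb, hab⟩, hc, hd⟩, rfl⟩
        have ha := hab.trans hb
        have hmod : (a + p * c) % p ≠ (b + p * d) % p := by
          simp [Nat.mod_eq_of_lt, ha, hb, hab.ne]
        refine ⟨⟨?_, _, _, fun h => hmod (congrArg (· % p) h), rfl⟩, ?_⟩
        · have : a + p * c < p ^ 2 ∧ b + p * d < p ^ 2 := by constructor <;> nlinarith
          simpa using this
        · simp only [Finset.mem_insert, Finset.mem_singleton]
          rintro _ (rfl | rfl) _ (rfl | rfl) h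
          exacts [rfl, absurd h hmod, absurd h.symm hmod, rfl]
    have hcount : (digitFamily p 4).card * 2 = p * (p - 1) * (p * p) := by
      rw [himage, Finset.card_image_of_injOn, Finset.card_product, Finset.card_sigma,
        Finset.card_product]
      · simp only [Finset.card_range]
        rw [mul_right_comm, Finset.sum_range_id_mul_two]
      · rintro ⟨⟨b, a⟩, c, d⟩ h ⟨⟨b', a'⟩, c', d'⟩ h' heq
        simp only [Finset.coe_product, Set.mem_prod, Finset.mem_coe, Finset.mem_sigma,
          Finset.mem_range] at h h'
        obtain ⟨⟨hb, hab⟩, hc, hd⟩ := h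
        obtain ⟨⟨hb', hab'⟩, hc', hd'⟩ := h'
        have ha := hab.trans hb
        have ha' := hab'.trans hb'
        have digits : ∀ {x y x' y' : ℕ}, x < p → x' < p → x + p * y = x' + p * y' →
            x = x' ∧ y = y' := by
          intro x y x' y' hx hx' h
          have hxx : x = x' := by
            have := congrArg (· % p) h
            simpa [Nat.mod_eq_of_lt, hx, hx'] using this
          subst hxx
          exact ⟨rfl, Nat.eq_of_mul_eq_mul_left hp.pos (by omega)⟩
        have h1 : a + p * c ∈ ({a' + p * c', b' + p * d'} : Finset ℕ) := by
          dsimp only at heq; rw [← heq]; simp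
        have h2 : b + p * d ∈ ({a' + p * c', b' + p * d'} : Finset ℕ) := by
          dsimp only at heq; rw [← heq]; simp
        simp only [Finset.mem_insert, Finset.mem_singleton] at h1 h2
        rcases h1 with h1 | h1 <;> rcases h2 with h2 | h2
        · have := (digits ha ha' h1).1; have := (digits hb ha' h2).1; omega
        · obtain ⟨rfl, rfl⟩ := digits ha ha' h1
          obtain ⟨rfl, rfl⟩ := digits hb hb' h2
          rfl
        · have := (digits ha hb' h1).1; have := (digits hb ha' h2).1; omega
        · have := (digits ha hb' h1).1; have := (digits hb hb' h2).1; omega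
    have hcast : (((digitFamily p 4).card * 2 : ℕ) : ℚ) = ((p * (p - 1) * (p * p) : ℕ) : ℚ) :=
      congrArg _ hcount
    push_cast [Nat.cast_sub hp.one_le] at hcast
    simp only [rootSetKindCount, Matrix.cons_val]
    linear_combination hcast / 2
  · rw [hcard k hk]
    have h3 : ((p.choose 3 : ℕ) : ℚ) = p * (p - 1) * (p - 2) / 6 := by
      clear hfilter hcard hp
      induction p with
      | zero => simp
      | succ n ih =>
        rw [Nat.choose_succ_succ']
        push_cast
        rw [Nat.cast_choose_two, ih]
        ring
    fin_cases k <;>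
      simp [kindLevel, kindSize, rootSetKindCount, Nat.cast_choose_two, h3] at hk ⊢

theorem ncard_rootSetKind {p : ℕ} (hp : p.Prime) (j : ℕ) (k : Fin 8) :
    ((rootSetKind p j k).ncard : ℚ) = rootSetKindCount (p : ℚ) k := by
  rw [rootSetKind_eq_image hp, Set.InjOn.ncard_image, Set.ncard_coe_finset, card_digitFamily hp]
  exact (subtreeUnion_injOn hp.ne_zero j (kindLevel_le k)).mono fun A hA =>
    (mem_digitFamily.mp hA).1.1

theorem ncard_of_mem_rootSetKind {p : ℕ} (hp : p.Prime) (j : ℕ) {k : Fin 8}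
    {T : Set (ZMod (p ^ 4))} (hT : T ∈ rootSetKind p j k) :
    T.ncard = kindSize k * p ^ (3 - kindLevel k) := by
  rw [rootSetKind_eq_image hp] at hT
  obtain ⟨A, hA, rfl⟩ := hT
  obtain ⟨⟨hlt, hcard⟩, -⟩ := mem_digitFamily.mp hA
  rw [ncard_subtreeUnion hp.ne_zero j (kindLevel_le k) hlt, hcard]

/-- The cardinalities `p ^ 3 > 3 p ^ 2 > 2 p ^ 2 > p ^ 2 > 2 p > p > 1 > 0` separate the kinds. -/
theorem pairwise_disjoint_rootSetKind {p : ℕ} (hp : p.Prime) (h5 : 5 ≤ p) (j : ℕ) :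
    Pairwise (Function.onFun Disjoint (rootSetKind p j)) := by
  have hanti : StrictAnti fun k => kindSize k * p ^ (3 - kindLevel k) := by
    rw [Fin.strictAnti_iff_succ_lt]
    intro k
    fin_cases k <;> simp [kindSize, kindLevel] <;> nlinarith
  intro k k' hk
  refine Set.disjoint_left.mpr fun T hT hT' => hk (hanti.injective ?_)
  rw [← ncard_of_mem_rootSetKind hp j hT, ncard_of_mem_rootSetKind hp j hT']

/-! ### Reduction to a congruence over the integers -/

theorem val_modEq_iff {p : ℕ} (hp : p ≠ 0) (j : ℕ) (x : ZMod (p ^ 4)) :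
    x.val ≡ j [MOD p] ↔ ∃ y, x = classPoint p j y := by
  have : NeZero (p ^ 4) := ⟨pow_ne_zero 4 hp⟩
  constructor
  · intro h
    obtain ⟨y, hy⟩ := Nat.modEq_iff_dvd.mp h.symm
    refine ⟨y, ?_⟩
    rw [classPoint, ← hy, add_sub_cancel, Int.cast_natCast, ZMod.natCast_zmod_val]
  · rintro ⟨y, hy⟩
    rw [← ZMod.natCast_zmod_val x, classPoint, ← Int.cast_natCast,
      ZMod.intCast_eq_intCast_iff_dvd_sub] at hy
    have hd := (show (p : ℤ) ∣ ((p ^ 4 : ℕ) : ℤ) by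
      push_cast; exact dvd_pow_self _ (by norm_num)).trans hy
    rw [Nat.modEq_iff_dvd]
    have := dvd_sub hd (dvd_mul_right (p : ℤ) y)
    rwa [show (j + p * y - x.val - p * y : ℤ) = j - x.val by ring] at this

/-- Taylor expansion at `j`: terms of degree at least four in `p y` vanish in `ℤ/p^4`. -/
theorem mem_possibleParts_iff {p : ℕ} (hp : p ≠ 0) (j : ℕ) (T : Set (ZMod (p ^ 4))) :
    T ∈ possibleParts p 4 j ↔ ∃ a₀ a₁ a₂ a₃ : ℤ, T = classPoint p j ''
      {y | (p : ℤ) ^ 4 ∣ a₀ + a₁ * (p * y) + a₂ * (p * y) ^ 2 + a₃ * (p * y) ^ 3} := by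
  have part_eq : ∀ (f : (ZMod (p ^ 4))[X]) (a₀ a₁ a₂ a₃ : ℤ),
      (∀ y : ℤ, f.eval (classPoint p j y) =
        ((a₀ + a₁ * (p * y) + a₂ * (p * y) ^ 2 + a₃ * (p * y) ^ 3 : ℤ) : ZMod (p ^ 4))) →
      residuePart p 4 j {x | f.eval x = 0} = classPoint p j ''
        {y | (p : ℤ) ^ 4 ∣ a₀ + a₁ * (p * y) + a₂ * (p * y) ^ 2 + a₃ * (p * y) ^ 3} := by
    intro f a₀ a₁ a₂ a₃ hf
    have hiff : ∀ y, f.eval (classPoint p j y) = 0 ↔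
        (p : ℤ) ^ 4 ∣ a₀ + a₁ * (p * y) + a₂ * (p * y) ^ 2 + a₃ * (p * y) ^ 3 := by
      intro y
      rw [hf, ZMod.intCast_zmod_eq_zero_iff_dvd, Nat.cast_pow]
    ext x
    constructor
    · rintro ⟨hx, hxj⟩
      obtain ⟨y, rfl⟩ := (val_modEq_iff hp j x).mp hxj
      exact ⟨y, (hiff y).mp hx, rfl⟩
    · rintro ⟨y, hy, rfl⟩
      exact ⟨(hiff y).mpr hy, (val_modEq_iff hp j _).mpr ⟨y, rfl⟩⟩
  constructor
  · rintro ⟨_, ⟨f, rfl⟩, rfl⟩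
    set g := taylor (j : ZMod (p ^ 4)) f with hg
    obtain ⟨a₀, h₀⟩ := ZMod.intCast_surjective (g.coeff 0)
    obtain ⟨a₁, h₁⟩ := ZMod.intCast_surjective (g.divX.coeff 0)
    obtain ⟨a₂, h₂⟩ := ZMod.intCast_surjective (g.divX.divX.coeff 0)
    obtain ⟨a₃, h₃⟩ := ZMod.intCast_surjective (g.divX.divX.divX.coeff 0)
    refine ⟨a₀, a₁, a₂, a₃, part_eq f a₀ a₁ a₂ a₃ fun y => ?_⟩
    have h4 : (p : ZMod (p ^ 4)) ^ 4 = 0 := by exact_mod_cast ZMod.natCast_self (p ^ 4)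
    have hdivX : ∀ (q : (ZMod (p ^ 4))[X]) (t : ZMod (p ^ 4)),
        q.eval t = q.divX.eval t * t + q.coeff 0 := by
      intro q t
      conv_lhs => rw [← divX_mul_X_add q]
      simp
    have hshift : f.eval (classPoint p j y) = g.eval (p * y : ZMod (p ^ 4)) := by
      rw [hg, taylor_eval, classPoint]
      push_cast
      rw [add_comm]
    rw [hshift, hdivX g, hdivX g.divX, hdivX g.divX.divX, hdivX g.divX.divX.divX,
      ← h₀, ← h₁, ← h₂, ← h₃]
    push_cast
    linear_combination
      (g.divX.divX.divX.divX.eval (p * y : ZMod (p ^ 4))) * (y : ZMod (p ^ 4)) ^ 4 * h4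
  · rintro ⟨a₀, a₁, a₂, a₃, rfl⟩
    refine ⟨_, ⟨C (a₀ : ZMod (p ^ 4)) + C (a₁ : ZMod (p ^ 4)) * (X - C (j : ZMod (p ^ 4))) +
      C (a₂ : ZMod (p ^ 4)) * (X - C (j : ZMod (p ^ 4))) ^ 2 +
      C (a₃ : ZMod (p ^ 4)) * (X - C (j : ZMod (p ^ 4))) ^ 3, rfl⟩,
      (part_eq _ a₀ a₁ a₂ a₃ fun y => ?_).symm⟩
    simp [classPoint]

/-! ### Classification of the solution sets -/

/-- `S` is the set of those `y` for which `j + p y` lies in a certain set of one of the eight kinds;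
this condition does not involve `j`. -/
def IsKindSet (p : ℕ) (S : Set ℤ) : Prop :=
  ∃ k, ∃ A ∈ digitFamily p k, S = residueUnion p (kindLevel k) A

/-- A residue class modulo `p ^ i` has a representative in `[0, p ^ i)`. -/
theorem exists_digit {p : ℕ} (hp : p.Prime) (i : ℕ) (c : ℤ) :
    ∃ n < p ^ i, ∀ y : ℤ, (p : ℤ) ^ i ∣ y - c ↔ (p : ℤ) ^ i ∣ y - n := by
  have hpos : (0 : ℤ) < (p : ℤ) ^ i := pow_pos (by exact_mod_cast hp.pos) i
  have hnn := Int.emod_nonneg c hpos.ne'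
  have hlt := Int.emod_lt_of_pos c hpos
  refine ⟨(c % (p : ℤ) ^ i).toNat, ?_, fun y => ?_⟩
  · zify
    rwa [Int.toNat_of_nonneg hnn]
  · rw [Int.toNat_of_nonneg hnn, Int.emod_def,
      show y - (c - (p : ℤ) ^ i * (c / (p : ℤ) ^ i)) = y - c + (p : ℤ) ^ i * (c / (p : ℤ) ^ i) by
        ring, dvd_add_left (dvd_mul_right _ _)]

theorem isKindSet_univ (p : ℕ) : IsKindSet p Set.univ :=
  ⟨0, {0}, by simp [mem_digitFamily, kindLevel, kindSize], by
    simp [residueUnion, kindLevel]⟩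

theorem isKindSet_empty (p : ℕ) : IsKindSet p ∅ :=
  ⟨7, ∅, by simp [mem_digitFamily, kindSize], by simp [residueUnion]⟩

theorem isKindSet_class {p : ℕ} (hp : p.Prime) {i : ℕ} (h1 : 1 ≤ i) (h3 : i ≤ 3) (c : ℤ) :
    IsKindSet p {y | (p : ℤ) ^ i ∣ y - c} := by
  obtain ⟨n, hn, hiff⟩ := exists_digit hp i c
  have hset : {y : ℤ | (p : ℤ) ^ i ∣ y - c} = residueUnion p i {n} := by
    ext y; simp [residueUnion, hiff]
  rw [hset]
  interval_cases i
  · exact ⟨3, {n}, by simpa [mem_digitFamily, kindLevel, kindSize] using hn, rfl⟩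
  · exact ⟨5, {n}, by simpa [mem_digitFamily, kindLevel, kindSize] using hn, rfl⟩
  · exact ⟨6, {n}, by simpa [mem_digitFamily, kindLevel, kindSize] using hn, rfl⟩

theorem isKindSet_union_classes {p : ℕ} (hp : p.Prime) {c d : ℤ} (hcd : ¬ (p : ℤ) ∣ c - d) :
    IsKindSet p {y | (p : ℤ) ^ 2 ∣ y - c ∨ (p : ℤ) ^ 2 ∣ y - d} := by
  obtain ⟨m, hm, hmc⟩ := exists_digit hp 2 c
  obtain ⟨n, hn, hnd⟩ := exists_digit hp 2 d
  have hmn : m % p ≠ n % p := by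
    intro h
    have h1 : (p : ℤ) ∣ n - m := Nat.modEq_iff_dvd.mp h
    have h2 := (dvd_pow_self (p : ℤ) two_ne_zero).trans ((hmc c).mp (by simp))
    have h3 := (dvd_pow_self (p : ℤ) two_ne_zero).trans ((hnd d).mp (by simp))
    have := dvd_sub (dvd_sub h2 h3) h1
    rw [show c - m - (d - n) - (n - m) = c - d by ring] at this
    exact hcd this
  refine ⟨4, {m, n}, mem_digitFamily.mpr ⟨⟨?_, ?_⟩, ?_⟩, ?_⟩
  · simpa [kindLevel] using ⟨hm, hn⟩
  · simp [kindSize, Finset.card_pair (fun h : m = n => hmn (h ▸ rfl))]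
  · simp [hmn, hmn.symm]
  · ext y
    simp [residueUnion, hmc, hnd, kindLevel]

theorem isKindSet_residueUnion {p : ℕ} {A : Finset ℕ} (hA : ∀ a ∈ A, a < p) (h3 : A.card ≤ 3) :
    IsKindSet p (residueUnion p 1 A) := by
  have hinj : ∀ a ∈ A, ∀ b ∈ A, a % p = b % p → a = b := fun a ha b hb h => by
    rwa [Nat.mod_eq_of_lt (hA a ha), Nat.mod_eq_of_lt (hA b hb)] at h
  obtain h | h | h | h : A.card = 0 ∨ A.card = 1 ∨ A.card = 2 ∨ A.card = 3 := by omega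
  · rw [Finset.card_eq_zero.mp h]
    simpa [residueUnion] using isKindSet_empty p
  · exact ⟨3, A, mem_digitFamily.mpr ⟨⟨by simpa [kindLevel] using hA, h⟩, hinj⟩, rfl⟩
  · exact ⟨2, A, mem_digitFamily.mpr ⟨⟨by simpa [kindLevel] using hA, h⟩, hinj⟩, rfl⟩
  · exact ⟨1, A, mem_digitFamily.mpr ⟨⟨by simpa [kindLevel] using hA, h⟩, hinj⟩, rfl⟩

theorem dvd_iff_cast {p : ℕ} (a : ℤ) : (p : ℤ) ∣ a ↔ (a : ZMod p) = 0 :=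
  (ZMod.intCast_zmod_eq_zero_iff_dvd a p).symm

theorem isKindSet_cubic {p : ℕ} (hp : p.Prime) (b₀ b₁ b₂ b₃ : ℤ) :
    IsKindSet p {y | (p : ℤ) ∣ b₀ + b₁ * y + b₂ * y ^ 2 + b₃ * y ^ 3} := by
  have : Fact p.Prime := ⟨hp⟩
  set P : (ZMod p)[X] := C (b₃ : ZMod p) * X ^ 3 + C (b₂ : ZMod p) * X ^ 2 +
    C (b₁ : ZMod p) * X + C (b₀ : ZMod p) with hP
  have hroot : ∀ y : ℤ, (p : ℤ) ∣ b₀ + b₁ * y + b₂ * y ^ 2 + b₃ * y ^ 3 ↔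
      P.eval (y : ZMod p) = 0 := by
    intro y
    rw [dvd_iff_cast, hP]
    simp only [eval_add, eval_mul, eval_C, eval_pow, eval_X]
    push_cast
    ring_nf
  by_cases h0 : P = 0
  · convert isKindSet_univ p
    ext y
    simp [hroot, h0]
  · set A : Finset ℕ := {n ∈ Finset.range p | P.eval (n : ZMod p) = 0} with hA
    have hlt : ∀ a ∈ A, a < p := fun a ha => Finset.mem_range.mp (Finset.mem_filter.mp ha).1
    have hset : {y : ℤ | (p : ℤ) ∣ b₀ + b₁ * y + b₂ * y ^ 2 + b₃ * y ^ 3} = residueUnion p 1 A := by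
      ext y
      simp only [Set.mem_ofPred_eq, hroot, residueUnion, pow_one]
      constructor
      · intro hy
        obtain ⟨n, hn, hiff⟩ := exists_digit hp 1 y
        simp only [pow_one] at hn hiff
        have hyn : (p : ℤ) ∣ y - n := (hiff y).mp (by simp)
        refine ⟨n, ?_, hyn⟩
        rw [dvd_iff_cast] at hyn
        push_cast at hyn
        rw [hA, Finset.mem_filter, ← sub_eq_zero.mp hyn]
        exact ⟨Finset.mem_range.mpr hn, hy⟩
      · rintro ⟨n, hn, hyn⟩
        rw [dvd_iff_cast] at hyn
        push_cast at hyn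
        rw [sub_eq_zero.mp hyn]
        exact (Finset.mem_filter.mp hn).2
    rw [hset]
    refine isKindSet_residueUnion hlt ?_
    have hinj : Set.InjOn (fun n : ℕ => (n : ZMod p)) A := by
      intro a ha b hb h
      exact ((ZMod.natCast_eq_natCast_iff a b p).mp h).eq_of_lt_of_lt (hlt a ha) (hlt b hb)
    rw [← Finset.card_image_of_injOn hinj]
    refine (card_le_degree_of_subset_roots (p := P) fun x hx => ?_).trans
      (by rw [hP]; exact natDegree_cubic_le)
    obtain ⟨n, hn, rfl⟩ := Finset.mem_image.mp (Finset.mem_val.mp hx)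
    exact (mem_roots h0).mpr (Finset.mem_filter.mp hn).2

/-- A polynomial function `g` of this shape has exactly one root modulo `p ^ n`, since
`g y - g z = (y - z) u` with `u ≡ a₁ (mod p)` makes `g` injective modulo `p ^ n`. -/
theorem exists_hensel {p : ℕ} (hp : p.Prime) (n : ℕ) {a₁ : ℤ} (h1 : ¬ (p : ℤ) ∣ a₁)
    (a₀ a₂ a₃ : ℤ) :
    ∃ z : ℤ, ∀ y : ℤ, (p : ℤ) ^ n ∣ a₀ + a₁ * y + p * a₂ * y ^ 2 + p ^ 2 * a₃ * y ^ 3 ↔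
      (p : ℤ) ^ n ∣ y - z := by
  have : NeZero (p ^ n) := ⟨pow_ne_zero n hp.ne_zero⟩
  set g : ℤ → ℤ := fun y => a₀ + a₁ * y + p * a₂ * y ^ 2 + p ^ 2 * a₃ * y ^ 3 with hg
  have hsub : ∀ y z, (p : ℤ) ^ n ∣ g y - g z ↔ (p : ℤ) ^ n ∣ y - z := by
    intro y z
    set u : ℤ := a₁ + p * (a₂ * (y + z) + p * a₃ * (y ^ 2 + y * z + z ^ 2)) with hu
    have hcop : IsCoprime ((p : ℤ) ^ n) u := by
      refine IsCoprime.pow_left ((Nat.prime_iff_prime_int.mp hp).coprime_iff_not_dvd.mpr ?_)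
      rwa [hu, dvd_add_left (dvd_mul_right _ _)]
    rw [show g y - g z = u * (y - z) by simp only [hg, hu]; ring]
    exact ⟨hcop.dvd_of_dvd_mul_left, fun h => h.mul_left u⟩
  -- The polynomial induces an injective, hence surjective, self-map of `ℤ/p^n`.
  have hinj : Function.Injective fun x : ZMod (p ^ n) => ((g x.val : ℤ) : ZMod (p ^ n)) := by
    intro x x' h
    rw [eq_comm, ZMod.intCast_eq_intCast_iff_dvd_sub, Nat.cast_pow, hsub] at h
    rw [← ZMod.natCast_zmod_val x, ← ZMod.natCast_zmod_val x', ← Int.cast_natCast,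
      ← Int.cast_natCast (x'.val), eq_comm, ZMod.intCast_eq_intCast_iff_dvd_sub, Nat.cast_pow]
    exact h
  obtain ⟨x, hx⟩ := Finite.surjective_of_injective hinj 0
  dsimp only at hx
  rw [ZMod.intCast_zmod_eq_zero_iff_dvd, Nat.cast_pow] at hx
  refine ⟨x.val, fun y => ?_⟩
  rw [← hsub, dvd_sub_left hx]

/-- A simple root `c` modulo `p` lifts to a unique root `d` modulo `p ^ 2`: for `y = c + p t` the
congruence becomes one modulo `p` in `t`, linear with slope the derivative at `c`. -/
theorem exists_simple_lift {p : ℕ} (hp : p.Prime) {a₀ a₁ a₂ a₃ c : ℤ}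
    (hc : (p : ℤ) ∣ a₀ + a₁ * c + a₂ * c ^ 2) (hs : ¬ (p : ℤ) ∣ a₁ + 2 * a₂ * c) :
    ∃ d : ℤ, (p : ℤ) ∣ d - c ∧ ∀ y : ℤ, (p : ℤ) ∣ y - c →
      ((p : ℤ) ^ 2 ∣ a₀ + a₁ * y + a₂ * y ^ 2 + p * a₃ * y ^ 3 ↔ (p : ℤ) ^ 2 ∣ y - d) := by
  have hp0 : (p : ℤ) ≠ 0 := by exact_mod_cast hp.ne_zero
  obtain ⟨u, hu⟩ := hc
  have hs' : ¬ (p : ℤ) ∣ a₁ + 2 * a₂ * c + p * (3 * a₃ * c ^ 2) := by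
    rwa [dvd_add_left (dvd_mul_right _ _)]
  obtain ⟨z, hz⟩ := exists_hensel hp 1 hs' (u + a₃ * c ^ 3) (a₂ + 3 * p * a₃ * c) (a₃ * p)
  refine ⟨c + p * z, ⟨z, by ring⟩, ?_⟩
  rintro y ⟨t, ht⟩
  obtain rfl : y = c + p * t := by linear_combination ht
  rw [show a₀ + a₁ * (c + p * t) + a₂ * (c + p * t) ^ 2 + p * a₃ * (c + p * t) ^ 3 =
    p * (u + a₃ * c ^ 3 + (a₁ + 2 * a₂ * c + p * (3 * a₃ * c ^ 2)) * t +
      p * (a₂ + 3 * p * a₃ * c) * t ^ 2 + p ^ 2 * (a₃ * p) * t ^ 3) by linear_combination hu,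
    show c + p * t - (c + p * z) = p * (t - z) by ring, sq (p : ℤ),
    mul_dvd_mul_iff_left hp0, mul_dvd_mul_iff_left hp0, ← sq]
  simpa only [pow_one] using hz t

theorem dvd_of_dvd_sq_dvd {p : ℕ} {a₀ a₁ a₂ a₃ y : ℤ}
    (h : (p : ℤ) ^ 2 ∣ a₀ + a₁ * y + a₂ * y ^ 2 + p * a₃ * y ^ 3) :
    (p : ℤ) ∣ a₀ + a₁ * y + a₂ * y ^ 2 := by
  have := (dvd_pow_self (p : ℤ) two_ne_zero).trans h
  rwa [mul_assoc (p : ℤ), dvd_add_left (dvd_mul_right _ _)] at this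

/-- The case of a nonzero quadratic reduction modulo `p`. Two distinct roots are automatically
simple and each contributes a class modulo `p ^ 2`. -/
theorem isKindSet_quadratic {p : ℕ} (hp : p.Prime) {a₀ a₁ a₂ : ℤ} (a₃ : ℤ)
    (hne : ¬ ((p : ℤ) ∣ a₀ ∧ (p : ℤ) ∣ a₁ ∧ (p : ℤ) ∣ a₂)) :
    IsKindSet p {y | (p : ℤ) ^ 2 ∣ a₀ + a₁ * y + a₂ * y ^ 2 + p * a₃ * y ^ 3} := by
  have : Fact p.Prime := ⟨hp⟩
  by_cases hroot : ∃ c : ℤ, (p : ℤ) ∣ a₀ + a₁ * c + a₂ * c ^ 2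
  swap
  · convert isKindSet_empty p
    exact Set.eq_empty_of_forall_notMem fun y hy => hroot ⟨y, dvd_of_dvd_sq_dvd hy⟩
  obtain ⟨c, hc⟩ := hroot
  by_cases hroot' : ∃ d : ℤ, (p : ℤ) ∣ a₀ + a₁ * d + a₂ * d ^ 2 ∧ ¬ (p : ℤ) ∣ c - d
  · obtain ⟨d, hd, hcd⟩ := hroot'
    have hsc : ¬ (p : ℤ) ∣ a₁ + 2 * a₂ * c := by
      simp only [dvd_iff_cast] at hc hd hcd hne ⊢
      push_cast at hc hd hcd ⊢
      grind
    have hsd : ¬ (p : ℤ) ∣ a₁ + 2 * a₂ * d := by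
      simp only [dvd_iff_cast] at hc hd hcd hne ⊢
      push_cast at hc hd hcd ⊢
      grind
    have honly : ∀ y : ℤ, (p : ℤ) ∣ a₀ + a₁ * y + a₂ * y ^ 2 →
        (p : ℤ) ∣ y - c ∨ (p : ℤ) ∣ y - d := by
      intro y hy
      simp only [dvd_iff_cast] at hc hd hcd hne hy ⊢
      push_cast at hc hd hcd hy ⊢
      grind
    obtain ⟨c', hcc', hc'⟩ := exists_simple_lift (a₃ := a₃) hp hc hsc
    obtain ⟨d', hdd', hd'⟩ := exists_simple_lift (a₃ := a₃) hp hd hsd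
    convert isKindSet_union_classes hp (c := c') (d := d') ?_ using 1
    · ext y
      simp only [Set.mem_ofPred_eq]
      constructor
      · intro hy
        exact (honly y (dvd_of_dvd_sq_dvd hy)).imp (fun h => (hc' y h).mp hy)
          fun h => (hd' y h).mp hy
      · rintro (h | h)
        · refine (hc' y ?_).mpr h
          simpa using dvd_add ((dvd_pow_self (p : ℤ) two_ne_zero).trans h) hcc'
        · refine (hd' y ?_).mpr h
          simpa using dvd_add ((dvd_pow_self (p : ℤ) two_ne_zero).trans h) hdd'
    · intro h
      have := dvd_add (dvd_sub h hcc') hdd'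
      rw [show c' - d' - (c' - c) + (d' - d) = c - d by ring] at this
      exact hcd this
  · have honly : ∀ y : ℤ, (p : ℤ) ∣ a₀ + a₁ * y + a₂ * y ^ 2 → (p : ℤ) ∣ y - c := by
      intro y hy
      by_contra h
      exact hroot' ⟨y, hy, by rwa [← dvd_neg, neg_sub]⟩
    by_cases hs : (p : ℤ) ∣ a₁ + 2 * a₂ * c
    · -- The polynomial is constant modulo `p ^ 2` on the class of a multiple root.
      have hconst : ∀ y : ℤ, (p : ℤ) ∣ y - c →
          ((p : ℤ) ^ 2 ∣ a₀ + a₁ * y + a₂ * y ^ 2 + p * a₃ * y ^ 3 ↔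
            (p : ℤ) ^ 2 ∣ a₀ + a₁ * c + a₂ * c ^ 2 + p * a₃ * c ^ 3) := by
        rintro y ⟨t, ht⟩
        obtain rfl : y = c + p * t := by linear_combination ht
        obtain ⟨s, hs⟩ := hs
        rw [show a₀ + a₁ * (c + p * t) + a₂ * (c + p * t) ^ 2 + p * a₃ * (c + p * t) ^ 3 =
          a₀ + a₁ * c + a₂ * c ^ 2 + p * a₃ * c ^ 3 + p ^ 2 * (s * t + a₂ * t ^ 2 +
            3 * a₃ * c ^ 2 * t + 3 * p * a₃ * c * t ^ 2 + p ^ 2 * a₃ * t ^ 3) by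
            linear_combination p * t * hs, dvd_add_left (dvd_mul_right _ _)]
      by_cases hcc : (p : ℤ) ^ 2 ∣ a₀ + a₁ * c + a₂ * c ^ 2 + p * a₃ * c ^ 3
      · convert isKindSet_class hp le_rfl (by norm_num) c using 1
        ext y
        simp only [Set.mem_ofPred_eq, pow_one]
        exact ⟨fun hy => honly y (dvd_of_dvd_sq_dvd hy), fun hy => (hconst y hy).mpr hcc⟩
      · convert isKindSet_empty p
        exact Set.eq_empty_of_forall_notMem fun y hy =>
          hcc ((hconst y (honly y (dvd_of_dvd_sq_dvd hy))).mp hy)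
    · obtain ⟨c', hcc', hc'⟩ := exists_simple_lift (a₃ := a₃) hp hc hs
      convert isKindSet_class hp one_le_two (by norm_num) c' using 1
      ext y
      simp only [Set.mem_ofPred_eq]
      refine ⟨fun hy => (hc' y (honly y (dvd_of_dvd_sq_dvd hy))).mp hy, fun h => (hc' y ?_).mpr h⟩
      simpa using dvd_add ((dvd_pow_self (p : ℤ) two_ne_zero).trans h) hcc'

theorem isKindSet_solutions {p : ℕ} (hp : p.Prime) (a₀ a₁ a₂ a₃ : ℤ) :
    IsKindSet p
      {y | (p : ℤ) ^ 4 ∣ a₀ + a₁ * (p * y) + a₂ * (p * y) ^ 2 + a₃ * (p * y) ^ 3} := by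
  have hp0 : (p : ℤ) ≠ 0 := by exact_mod_cast hp.ne_zero
  by_cases h0 : (p : ℤ) ∣ a₀
  swap
  · convert isKindSet_empty p
    refine Set.eq_empty_of_forall_notMem fun y hy => h0 ?_
    have := (dvd_pow_self (p : ℤ) four_ne_zero).trans hy
    rwa [show a₀ + a₁ * (p * y) + a₂ * (p * y) ^ 2 + a₃ * (p * y) ^ 3 =
      a₀ + p * (a₁ * y + a₂ * p * y ^ 2 + a₃ * p ^ 2 * y ^ 3) by ring,
      dvd_add_left (dvd_mul_right _ _)] at this
  obtain ⟨b₀, rfl⟩ := h0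
  by_cases h1 : (p : ℤ) ∣ a₁
  swap
  · obtain ⟨z, hz⟩ := exists_hensel hp 3 h1 b₀ a₂ a₃
    convert isKindSet_class hp (by norm_num) le_rfl z using 1
    ext y
    rw [Set.mem_ofPred_eq, Set.mem_ofPred_eq, ← hz,
      show p * b₀ + a₁ * (p * y) + a₂ * (p * y) ^ 2 + a₃ * (p * y) ^ 3 =
      p * (b₀ + a₁ * y + p * a₂ * y ^ 2 + p ^ 2 * a₃ * y ^ 3) by ring, pow_succ' _ 3,
      mul_dvd_mul_iff_left hp0]
  obtain ⟨b₁, rfl⟩ := h1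
  by_cases hb0 : (p : ℤ) ∣ b₀
  swap
  · convert isKindSet_empty p
    refine Set.eq_empty_of_forall_notMem fun y hy => hb0 ?_
    have := (pow_dvd_pow (p : ℤ) (show 2 ≤ 4 by norm_num)).trans hy
    rwa [show p * b₀ + p * b₁ * (p * y) + a₂ * (p * y) ^ 2 + a₃ * (p * y) ^ 3 =
      p * (b₀ + p * (b₁ * y + a₂ * y ^ 2 + a₃ * p * y ^ 3)) by ring, sq,
      mul_dvd_mul_iff_left hp0, dvd_add_left (dvd_mul_right _ _)] at this
  obtain ⟨c₀, rfl⟩ := hb0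
  have hset : {y : ℤ | (p : ℤ) ^ 4 ∣ p * (p * c₀) + p * b₁ * (p * y) + a₂ * (p * y) ^ 2 +
      a₃ * (p * y) ^ 3} = {y | (p : ℤ) ^ 2 ∣ c₀ + b₁ * y + a₂ * y ^ 2 + p * a₃ * y ^ 3} := by
    ext y
    rw [Set.mem_ofPred_eq, Set.mem_ofPred_eq,
      ← mul_dvd_mul_iff_left (pow_ne_zero 2 hp0) (c := c₀ + _ + _ + _), ← pow_add]
    ring_nf
  rw [hset]
  by_cases hall : (p : ℤ) ∣ c₀ ∧ (p : ℤ) ∣ b₁ ∧ (p : ℤ) ∣ a₂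
  · obtain ⟨⟨d₀, rfl⟩, ⟨d₁, rfl⟩, ⟨d₂, rfl⟩⟩ := hall
    convert isKindSet_cubic hp d₀ d₁ d₂ a₃ using 1
    ext y
    rw [Set.mem_ofPred_eq, Set.mem_ofPred_eq,
      ← mul_dvd_mul_iff_left hp0 (c := d₀ + _ + _ + _), ← sq]
    ring_nf
  · exact isKindSet_quadratic hp a₃ hall

/-! ### Realisation of the eight kinds -/

theorem pow_dvd_mul_sub_iff {p : ℕ} (hp : p.Prime) {c d : ℤ} (hcd : ¬ (p : ℤ) ∣ c - d) (n : ℕ)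
    (y : ℤ) : (p : ℤ) ^ n ∣ (y - c) * (y - d) ↔ (p : ℤ) ^ n ∣ y - c ∨ (p : ℤ) ^ n ∣ y - d := by
  have hprime := Nat.prime_iff_prime_int.mp hp
  refine ⟨fun h => ?_, fun h => h.elim (fun h => h.mul_right _) fun h => h.mul_left _⟩
  by_cases hc : (p : ℤ) ∣ y - c
  · refine .inl (IsCoprime.dvd_of_dvd_mul_right ?_ h)
    refine IsCoprime.pow_left (hprime.coprime_iff_not_dvd.mpr fun hd => hcd ?_)
    simpa using dvd_sub hd hc
  · exact .inr (IsCoprime.dvd_of_dvd_mul_left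
      (IsCoprime.pow_left (hprime.coprime_iff_not_dvd.mpr hc)) h)

/-- With `m` indices of level `i`, the polynomial is `p ^ (4 - i) * ∏ c ∈ A, (y - c)` if `m ≠ 0`.
The power of `p` makes the coefficient of `y ^ l` divisible by `p ^ l`, because `m + i ≤ 4`. For
`A = ∅` the constant `1` serves. -/
theorem exists_coeffs {p : ℕ} (hp : p.Prime) {k : Fin 8} {A : Finset ℕ} (hA : A ∈ digitFamily p k) :
    ∃ a₀ a₁ a₂ a₃ : ℤ, residueUnion p (kindLevel k) A =
      {y | (p : ℤ) ^ 4 ∣ a₀ + a₁ * (p * y) + a₂ * (p * y) ^ 2 + a₃ * (p * y) ^ 3} := by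
  have hp0 : (p : ℤ) ≠ 0 := by exact_mod_cast hp.ne_zero
  have hprime := Nat.prime_iff_prime_int.mp hp
  have hcancel : ∀ (i l : ℕ) (e : ℤ), l + i = 4 →
      ((p : ℤ) ^ 4 ∣ p ^ l * e ↔ (p : ℤ) ^ i ∣ e) := by
    intro i l e h
    rw [← h, pow_add, mul_dvd_mul_iff_left (pow_ne_zero l hp0)]
  have single : ∀ (i : ℕ) (c : ℕ), i ≤ 3 → residueUnion p i {c} =
      {y | (p : ℤ) ^ 4 ∣ -(p ^ (4 - i) * c) + p ^ (3 - i) * (p * y) + 0 * (p * y) ^ 2 +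
        0 * (p * y) ^ 3} := by
    intro i c hi
    ext y
    rw [Set.mem_ofPred_eq, show (-(p ^ (4 - i) * c) + p ^ (3 - i) * (p * y) + 0 * (p * y) ^ 2 +
        0 * (p * y) ^ 3 : ℤ) = p ^ (4 - i) * (y - c) by
      rw [show 4 - i = 3 - i + 1 by omega]; ring, hcancel i _ _ (by omega)]
    simp [residueUnion]
  have pair : ∀ (i : ℕ) (c d : ℕ), i ≤ 2 → ¬ (p : ℤ) ∣ c - d → residueUnion p i {c, d} =
      {y | (p : ℤ) ^ 4 ∣ p ^ (4 - i) * (c * d) + -(p ^ (3 - i) * (c + d)) * (p * y) +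
        p ^ (2 - i) * (p * y) ^ 2 + 0 * (p * y) ^ 3} := by
    intro i c d hi hcd
    ext y
    rw [Set.mem_ofPred_eq, show (p ^ (4 - i) * (c * d) + -(p ^ (3 - i) * (c + d)) * (p * y) +
        p ^ (2 - i) * (p * y) ^ 2 + 0 * (p * y) ^ 3 : ℤ) = p ^ (4 - i) * ((y - c) * (y - d)) by
      rw [show 4 - i = 2 - i + 2 by omega, show 3 - i = 2 - i + 1 by omega]; ring,
      hcancel i _ _ (by omega), pow_dvd_mul_sub_iff hp hcd]
    simp [residueUnion]
  obtain ⟨⟨-, hcard⟩, hinj⟩ := mem_digitFamily.mp hA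
  have hndvd : ∀ c ∈ A, ∀ d ∈ A, c ≠ d → ¬ (p : ℤ) ∣ c - d := fun c hc d hd hcd h =>
    hcd (hinj c hc d hd (Nat.modEq_iff_dvd.mpr h).symm)
  obtain hk | hk | hk | hk : kindSize k = 0 ∨ kindSize k = 1 ∨
      (kindSize k = 2 ∧ kindLevel k ≤ 2) ∨ (kindSize k = 3 ∧ kindLevel k = 1) := by
    clear hA hcard; revert k; decide
  · obtain rfl := Finset.card_eq_zero.mp (hcard.trans hk)
    refine ⟨1, 0, 0, 0, ?_⟩
    have : ¬ (p : ℤ) ^ 4 ∣ 1 := fun h =>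
      hprime.not_isUnit (isUnit_of_dvd_one ((dvd_pow_self (p : ℤ) four_ne_zero).trans h))
    simp [residueUnion, this]
  · obtain ⟨c, rfl⟩ := Finset.card_eq_one.mp (hcard.trans hk)
    exact ⟨_, _, _, _, single _ c (kindLevel_le k)⟩
  · obtain ⟨c, d, hcd, rfl⟩ := Finset.card_eq_two.mp (hcard.trans hk.1)
    exact ⟨_, _, _, _, pair _ c d hk.2 (hndvd c (by simp) d (by simp) hcd)⟩
  · obtain ⟨a, b, c, -, -, -, rfl⟩ := Finset.card_eq_three.mp (hcard.trans hk.1)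
    refine ⟨-(p ^ 3 * (a * b * c)), p ^ 2 * (a * b + a * c + b * c), -(p * (a + b + c)), 1, ?_⟩
    ext y
    rw [Set.mem_ofPred_eq, show (-(p ^ 3 * (a * b * c)) + p ^ 2 * (a * b + a * c + b * c) *
        (p * y) + -(p * (a + b + c)) * (p * y) ^ 2 + 1 * (p * y) ^ 3 : ℤ) =
        p ^ 3 * ((y - a) * ((y - b) * (y - c))) by ring, hcancel 1 3 _ rfl, pow_one,
      hprime.dvd_mul, hprime.dvd_mul, hk.2]
    simp [residueUnion]

theorem possibleParts_eq_iUnion {p : ℕ} (hp : p.Prime) (j : ℕ) :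
    possibleParts p 4 j = ⋃ k, rootSetKind p j k := by
  ext T
  simp only [mem_possibleParts_iff hp.ne_zero, Set.mem_iUnion, rootSetKind_eq_image hp]
  constructor
  · rintro ⟨a₀, a₁, a₂, a₃, rfl⟩
    obtain ⟨k, A, hA, hS⟩ := isKindSet_solutions hp a₀ a₁ a₂ a₃
    exact ⟨k, A, hA, by rw [hS, subtreeUnion]⟩
  · rintro ⟨k, A, hA, rfl⟩
    obtain ⟨a₀, a₁, a₂, a₃, h⟩ := exists_coeffs hp hA
    exact ⟨a₀, a₁, a₂, a₃, by rw [← h, subtreeUnion]⟩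

theorem mainTheorem6 (p : ℕ) (hp : p.Prime) (j : ℕ) (hj : j < p) :
    (∀ T : Set (ZMod (p ^ 4)), T ∈ possibleParts p 4 j ↔ ∃ i : Fin 8, T ∈ rootSetKind p j i) ∧
    (∀ i : Fin 8, ((rootSetKind p j i).ncard : ℚ) = rootSetKindCount (p : ℚ) i) ∧
    (5 ≤ p →
      (∀ i i' : Fin 8, i ≠ i' → Disjoint (rootSetKind p j i) (rootSetKind p j i')) ∧
      ((possibleParts p 4 j).ncard : ℚ) =
        (3 * (p : ℚ) ^ 4 + 4 * (p : ℚ) ^ 3 + 6 * (p : ℚ) ^ 2 + 5 * (p : ℚ) + 12) / 6) := by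
  refine ⟨fun T => by rw [possibleParts_eq_iUnion hp, Set.mem_iUnion], ncard_rootSetKind hp j,
    fun h5 => ⟨fun i i' h => pairwise_disjoint_rootSetKind hp h5 j h, ?_⟩⟩
  have hfin : ∀ k, (rootSetKind p j k).Finite := fun k => by
    rw [rootSetKind_eq_image hp]
    exact (Finset.finite_toSet _).image _
  rw [possibleParts_eq_iUnion hp, Set.ncard_iUnion_of_finite hfin
    (pairwise_disjoint_rootSetKind hp h5 j), finsum_eq_sum_of_fintype, Nat.cast_sum,
    Finset.sum_congr rfl fun k _ => ncard_rootSetKind hp j k]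
  simp only [Fin.sum_univ_eight, rootSetKindCount, Matrix.cons_val]
  ring
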